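/- Let $X$ be a finite set, $H:X\to\mathbb{R}$, and let $q(x,y)=q(y,x)\ge 0$ ($x\neq y$) be a connection matrix with $\sum_{y\ne x}q(x,y)\le 1$ for all $x$. For $\beta>0$ consider the Metropolis dynamics $$p_\beta(x,y)=q(x,y)\,e^{-\beta[H(y)-H(x)]_+}\quad(x\ne y),\qquad p_\beta(x,x)=1-\sum_{y\neq x}p_\beta(x,y),$$ assumed irreducible, with reversible measure $\mu_\beta(x)=e^{-\beta H(x)}/Z_\beta$, $Z_\beta=\sum_{y}e^{-\beta H(y)}$. For disjoint nonempty $Y,Y'\subset X$ let $$\mathrm{cap}_\beta(Y,Y')=\min_{f:X\to[0,1],\,f|_Y=1,\,f|_{Y'}=0}\ \tfrac12\sum_{y,z\in X}\mu_\beta(y)p_\beta(y,z)[f(y)-f(z)]^2 .$$ A path is a finite sequence of states $\omega_1,\dots,\omega_n$, $n\ge1$, with $p_\beta(\omega_i,\omega_{i+1})>0$ for all $i<n$; with the cost $\Delta(y,z)=[H(z)-H(y)]_+$ of an allowed jump, its height is $\Phi_\omega=\max_{i<n}[H(\omega_i)+\Delta(\omega_i,\omega_{i+1})]$ (and $H(\omega_1)$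 if $n=1$). The communication height $\Phi(Y,Y')$ is the minimum of $\Phi_\omega$ over the paths $\omega$ from $Y$ to $Y'$. Let $X_{\rm s}$ be the set of absolute minima of $H$; for $x\notin X_{\rm s}$ let $V_x=\Phi(x,\{y:H(y)<H(x)\})-H(x)$, let $\Gamma_{\rm m}=\max_{x\notin X_{\rm s}}V_x$, and let $X_{\rm m}=\{x\notin X_{\rm s}:V_x=\Gamma_{\rm m}\}$. Assume that there are states $x_0,x_1,x_2$ with $X_{\rm s}=\{x_0\}$, $X_{\rm m}=\{x_1,x_2\}$, $H(x_2)>H(x_1)$, and that $\Gamma_{\rm m}>0$. Let $x\in\{x_2,x_1\}$ and $A=\{x_0,x_1\}\setminus\{x\}$, and put $$Q_x=\{y:\Phi(y,x)<\Phi(x,A)\},\qquad Q_A=\{y:\Phi(y,A)<\Phi(x,A)\}.$$ Call a path from $x$ to $A$ optimal if its height is $\Phi(x,A)$. A gate for $x$ and $A$ is a set $\mathcal{W}\subset\{z\in X:H(z)=\Phi(x,A)\}$ that meets every optimal path from $x$ to $A$; it is minimal if for every proper subset $\mathcal{W}'$ of $\mathcal{W}$ there is an optimal path from $x$ to $A$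 that does not meet $\mathcal{W}'$. Assume that there is exactly one minimal gate $\mathcal{W}$ for $x$ and $A$ and that $p_\beta(y,w)\to0$ as $\beta\to\infty$ for all $y\in\mathcal{W}$ and all $w\notin Q_x\cup Q_A$ with $w\ne y$. Then, as $\beta\to\infty$, $$\mathrm{cap}_\beta(x,A)=\frac{k}{Z_\beta}\,e^{-\beta\Phi(x,A)}\,[1+o(1)],\qquad k=\sum_{z\in\mathcal{W}}\frac{\check p(z)\,\hat p(z)}{\check p(z)+\hat p(z)},$$ where $\check p(z)=\sum_{w\in Q_x}p_\beta(z,w)$ and $\hat p(z)=\sum_{w\in Q_A}p_\beta(z,w)$; in particular, $k$ does not depend on $\beta>0$. -/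

import Mathlib

open Filter Topology

/-- The Metropolis transition matrix with connection matrix `q`, energy `H` and inverse
temperature `β`: `p x y = q x y * exp (-β [H y - H x]₊)` for `x ≠ y`, and the diagonal entry
makes every row sum to one. -/
noncomputable def metropolisMatrix {X : Type*} [Fintype X] [DecidableEq X]
    (q : X → X → ℝ) (H : X → ℝ) (β : ℝ) : Matrix X X ℝ := fun x y =>
  if x = y then 1 - ∑ z ∈ Finset.univ.erase x, q x z * Real.exp (-β * max (H z - H x) 0)
  else q x y * Real.exp (-β * max (H y - H x) 0)

/-- A Metropolis dynamics on the finite state space `X`: an energy function and a symmetric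
connection matrix (only its off-diagonal entries matter) such that the transition matrices are
stochastic and irreducible at every positive inverse temperature. -/
structure MetropolisDynamics (X : Type*) [Fintype X] [DecidableEq X] where
  /-- the energy (Hamiltonian) -/
  H : X → ℝ
  /-- the connection matrix -/
  q : X → X → ℝ
  q_symm : ∀ x y, q x y = q y x
  q_nonneg : ∀ x y, x ≠ y → 0 ≤ q x y
  q_sum_le_one : ∀ x, ∑ y ∈ Finset.univ.erase x, q x y ≤ 1
  irreducible : ∀ β : ℝ, 0 < β → (metropolisMatrix q H β).IsIrreducible

namespace MetropolisDynamics

variable {X : Type*} [Fintype X] [DecidableEq X] (M : MetropolisDynamics X)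

/-- The transition probabilities `p_β(x, y)`. -/
noncomputable def p (β : ℝ) (x y : X) : ℝ := metropolisMatrix M.q M.H β x y

/-- The partition function `Z_β`. -/
noncomputable def Z (β : ℝ) : ℝ := ∑ x, Real.exp (-β * M.H x)

/-- The Gibbs measure `μ_β`. -/
noncomputable def gibbs (β : ℝ) (x : X) : ℝ := Real.exp (-β * M.H x) / M.Z β

/-- The Dirichlet form. -/
noncomputable def dirichlet (β : ℝ) (f : X → ℝ) : ℝ :=
  1 / 2 * ∑ y, ∑ z, M.gibbs β y * M.p β y z * (f y - f z) ^ 2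

/-- The capacity of the pair `A`, `B` of (nonempty, disjoint) sets: the minimum of the Dirichlet
form over the functions `X → [0, 1]` that are `1` on `A` and `0` on `B`. -/
noncomputable def cap (β : ℝ) (A B : Set X) : ℝ :=
  sInf (M.dirichlet β '' {f | (∀ y, f y ∈ Set.Icc (0 : ℝ) 1) ∧ (∀ y ∈ A, f y = 1) ∧
    ∀ y ∈ B, f y = 0})

/-- The jump from `x` to `y` is allowed. (For Metropolis dynamics the positivity of `p_β(x, y)`
does not depend on `β > 0`.) -/
def Allowed (x y : X) : Prop := ∀ β : ℝ, 0 < β → 0 < M.p β x y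

/-- The cost `Δ(x, y)` of an allowed jump; it is only used for allowed jumps (the cost of the
others is infinite). -/
noncomputable def cost (x y : X) : ℝ := max (M.H y - M.H x) 0

/-- `ω` is a path joining a state of `A` to a state of `B`: a nonempty finite sequence of states
whose consecutive jumps are allowed. -/
def IsPath (A B : Set X) (ω : List X) : Prop :=
  ω.IsChain M.Allowed ∧ (∃ a ∈ A, ω.head? = some a) ∧ (∃ b ∈ B, ω.getLast? = some b)

/-- The height of a path: the maximum of `H (ω i) + Δ (ω i, ω (i+1))` along the jumps of the path
(the energy of the last state never exceeds the term of the last jump); the height of a path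
without jumps is the energy of its only state. -/
noncomputable def height : List X → ℝ
  | [] => 0
  | [x] => M.H x
  | x :: y :: l => max (M.H x + M.cost x y) (height (y :: l))

/-- The communication height `Φ(A, B)` between two nonempty sets. -/
noncomputable def commHeight (A B : Set X) : ℝ := sInf (M.height '' {ω | M.IsPath A B ω})

/-- The set `X_s` of ground states. -/
def groundStates : Set X := {x | ∀ y, M.H x ≤ M.H y}

/-- The stability level `V_x` of a state that is not a ground state. -/
noncomputable def stabilityLevel (x : X) : ℝ :=
  M.commHeight {x} {y | M.H y < M.H x} - M.H x

/-- The maximal stability level `Γ_m`. -/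
noncomputable def maxStabilityLevel : ℝ := sSup (M.stabilityLevel '' M.groundStatesᶜ)

/-- The set `X_m` of metastable states. -/
def metastableStates : Set X :=
  {x | x ∉ M.groundStates ∧ M.stabilityLevel x = M.maxStabilityLevel}

/-- The states at communication height below `Φ(x, A)` from `B`. It is `Q_x` for `B = {x}` and
`Q_A` for `B = A`. -/
def basin (x : X) (A B : Set X) : Set X := {y | M.commHeight {y} B < M.commHeight {x} A}

/-- The set of saddles for the pair `x`, `A`. -/
def saddles (x : X) (A : Set X) : Set X := {y | M.H y = M.commHeight {x} A}

/-- `ω` is an optimal path from `x` to `A`. -/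
def IsOptimalPath (x : X) (A : Set X) (ω : List X) : Prop :=
  M.IsPath {x} A ω ∧ M.height ω = M.commHeight {x} A

/-- `W` is a gate for the pair `x`, `A`. -/
def IsGate (x : X) (A : Set X) (W : Finset X) : Prop :=
  (W : Set X) ⊆ M.saddles x A ∧ ∀ ω, M.IsOptimalPath x A ω → ∃ z ∈ W, z ∈ ω

/-- `W` is a minimal gate for the pair `x`, `A`. -/
def IsMinimalGate (x : X) (A : Set X) (W : Finset X) : Prop :=
  M.IsGate x A W ∧ ∀ W', W' ⊂ W → ∃ ω, M.IsOptimalPath x A ω ∧ ∀ z ∈ W', z ∉ ω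

open Classical in
/-- The probability to jump from `z` into the set `B` in one step. -/
noncomputable def pInto (β : ℝ) (z : X) (B : Set X) : ℝ :=
  ∑ w ∈ Finset.univ.filter (fun w => w ∈ B), M.p β z w

end MetropolisDynamics

namespace MetropolisDynamics

variable {X : Type*} [Fintype X] [DecidableEq X] (M : MetropolisDynamics X)

/-! ### Transition probabilities and allowed jumps -/

/-! Write Φ for Φ(x, A). Multiplied by `Z β * exp (β Φ)`, the Dirichlet form becomes a resistor
network with conductances q(y,z) exp(-β(max(H y, H z) - Φ)): as β → ∞, bonds above Φ are cut and
bonds below Φ become perfect conductors. Competitors of bounded energy are therefore nearly 1 on Q_x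
and nearly 0 on Q_A (`eventually_abs_sub_le_of_reach`). If only the bonds from the gate to the two
basins are kept, each gate state is a node between potentials 1 and 0, and optimizing its value
leaves two conductances in series (`mul_div_add_le`). This is the lower bound
`eventually_le_energy`.

The upper bound `exists_tendsto_energy` uses one test function for all β: 1 on the component C of x
in {H ≤ Φ} \ W, the equilibrium value on W, 0 elsewhere. The gate property separates C from Q_A,
bonds from C to the outside of C ∪ W lie above Φ, and `hout` kills the remaining bonds at W.

Uniqueness of the minimal gate makes each of its states adjacent to both basins (`pInto_basin_pos`),
so k > 0 and the error is relative. Metastability enters only through H a < H x < Φ for a ∈ A. -/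

lemma p_of_ne (β : ℝ) {y z : X} (h : y ≠ z) :
    M.p β y z = M.q y z * Real.exp (-β * max (M.H z - M.H y) 0) := by
  simp [p, metropolisMatrix, h]

lemma allowed_iff {y z : X} (h : y ≠ z) : M.Allowed y z ↔ 0 < M.q y z := by
  simp only [Allowed, M.p_of_ne _ h]
  exact ⟨fun H => pos_of_mul_pos_left (H 1 one_pos) (Real.exp_pos _).le,
    fun H β _ => mul_pos H (Real.exp_pos _)⟩

lemma Allowed.symm {M : MetropolisDynamics X} {y z : X} (h : M.Allowed y z) : M.Allowed z y := by
  rcases eq_or_ne y z with rfl | hne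
  · exact h
  · rw [M.allowed_iff hne.symm, M.q_symm]
    exact (M.allowed_iff hne).1 h

/-! ### Paths inside a set of states -/

/-- `z` can be reached from `y` by allowed jumps between states satisfying `P`. -/
def Reach (P : X → Prop) : X → X → Prop :=
  Relation.ReflTransGen fun y z => M.Allowed y z ∧ P y ∧ P z

variable {M}

lemma Reach.symm {P : X → Prop} {y z : X} (h : M.Reach P y z) : M.Reach P z y :=
  have : Std.Symm fun y z => M.Allowed y z ∧ P y ∧ P z :=
    ⟨fun _ _ ⟨h1, h2, h3⟩ => ⟨h1.symm, h3, h2⟩⟩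
  Relation.ReflTransGen.stdSymm.symm _ _ h

lemma Reach.trans {P : X → Prop} {x y z : X} (h : M.Reach P x y) (h' : M.Reach P y z) :
    M.Reach P x z :=
  Relation.ReflTransGen.trans h h'

lemma Reach.mono {P Q : X → Prop} (hPQ : ∀ v, P v → Q v) {y z : X} (h : M.Reach P y z) :
    M.Reach Q y z :=
  Relation.ReflTransGen.mono (fun _ _ ⟨h1, h2, h3⟩ => ⟨h1, hPQ _ h2, hPQ _ h3⟩) _ _ h

variable (M)

lemma exists_isPath_of_reach {P : X → Prop} {A B : Set X} {a b : X} (ha : a ∈ A) (hb : b ∈ B)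
    (hPa : P a) (h : M.Reach P a b) : ∃ ω, M.IsPath A B ω ∧ ∀ v ∈ ω, P v := by
  suffices ∃ l : List X, (a :: l).IsChain M.Allowed ∧ (a :: l).getLast? = some b ∧
      ∀ v ∈ a :: l, P v by
    obtain ⟨l, h1, h2, h3⟩ := this
    exact ⟨a :: l, ⟨h1, ⟨a, ha, rfl⟩, ⟨b, hb, h2⟩⟩, h3⟩
  clear ha
  unfold Reach at h
  induction h using Relation.ReflTransGen.head_induction_on with
  | refl => exact ⟨[], by simp, by simp, by simpa using hPa⟩
  | head hcd _ ih =>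
    obtain ⟨l, h1, h2, h3⟩ := ih hcd.2.2
    refine ⟨_ :: l, List.IsChain.cons_cons hcd.1 h1, by simpa using h2, ?_⟩
    intro v hv
    rcases List.mem_cons.1 hv with rfl | hv
    · exact hPa
    · exact h3 v hv

lemma IsPath.ne_nil {M : MetropolisDynamics X} {A B : Set X} {ω : List X} (h : M.IsPath A B ω) :
    ω ≠ [] := by
  rintro rfl
  obtain ⟨a, _, ha⟩ := h.2.1
  simp at ha

lemma IsPath.exists_reach {M : MetropolisDynamics X} {P : X → Prop} {A B : Set X} {ω : List X}
    (h : M.IsPath A B ω) (hP : ∀ v ∈ ω, P v) :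
    ∃ a ∈ A, ∃ b ∈ B, P a ∧ M.Reach P a b := by
  have hne := h.ne_nil
  obtain ⟨hc, ⟨a, ha, hha⟩, ⟨b, hb, hlb⟩⟩ := h
  have h1 : ω.head hne = a := by
    rw [List.head?_eq_some_head hne] at hha; simpa using hha
  have h2 : ω.getLast hne = b := by
    rw [List.getLast?_eq_some_getLast hne] at hlb; simpa using hlb
  refine ⟨a, ha, b, hb, hP a (h1 ▸ List.head_mem hne), ?_⟩
  rw [← h1, ← h2]
  refine List.relationReflTransGen_of_exists_isChain ω ?_ hne
  exact hc.imp_of_mem_imp fun y z hy hz hyz => ⟨hyz, hP y hy, hP z hz⟩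

lemma reach_true (y z : X) : M.Reach (fun _ => True) y z := by
  -- One inverse temperature suffices: positivity of an off-diagonal entry does not depend on β, and
  -- loops can be dropped.
  let : Quiver X := Matrix.toQuiver (metropolisMatrix M.q M.H 1)
  obtain ⟨w, -⟩ := (M.irreducible 1 one_pos).connected y z
  induction w with
  | nil => exact Relation.ReflTransGen.refl
  | @cons b c _ e ih =>
    have hpos : 0 < M.p 1 b c := e.down
    rcases eq_or_ne b c with rfl | hne
    · exact ih
    · refine Relation.ReflTransGen.tail ih ⟨(M.allowed_iff hne).2 ?_, trivial, trivial⟩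
      rw [M.p_of_ne 1 hne] at hpos
      exact pos_of_mul_pos_left hpos (Real.exp_pos _).le

/-! ### Heights -/

/-- Because of this identity the height of a path is just the largest energy it visits. -/
lemma add_cost (y z : X) : M.H y + M.cost y z = max (M.H y) (M.H z) := by
  rw [cost, max_comm (M.H y), ← max_add_add_left]; simp

lemma exists_mem_height_eq : ∀ {ω : List X}, ω ≠ [] → ∃ v ∈ ω, M.height ω = M.H v
  | [], h => absurd rfl h
  | [x], _ => ⟨x, by simp, rfl⟩
  | x :: y :: l, _ => by
    obtain ⟨v, hv, hv'⟩ := exists_mem_height_eq (ω := y :: l) (by simp)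
    rw [height, M.add_cost, hv']
    rcases max_choice (max (M.H x) (M.H y)) (M.H v) with h | h
    · rcases max_choice (M.H x) (M.H y) with h' | h'
      · exact ⟨x, by simp, h.trans h'⟩
      · exact ⟨y, by simp, h.trans h'⟩
    · exact ⟨v, List.mem_cons_of_mem _ hv, h⟩

lemma le_height : ∀ {ω : List X} {v : X}, v ∈ ω → M.H v ≤ M.height ω
  | [], _, h => by simp at h
  | [x], v, h => by
    obtain rfl : v = x := by simpa using h
    exact le_rfl
  | x :: y :: l, v, h => by
    rw [height, M.add_cost]
    rcases List.mem_cons.1 h with rfl | h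
    · exact (le_max_left _ _).trans (le_max_left _ _)
    · exact (le_height h).trans (le_max_right _ _)

lemma finite_heights (A B : Set X) : (M.height '' {ω | M.IsPath A B ω}).Finite := by
  refine (Set.finite_range M.H).subset ?_
  rintro _ ⟨ω, hω, rfl⟩
  obtain ⟨v, _, hv⟩ := M.exists_mem_height_eq (IsPath.ne_nil hω)
  exact ⟨v, hv.symm⟩

lemma commHeight_le {A B : Set X} {ω : List X} (h : M.IsPath A B ω) :
    M.commHeight A B ≤ M.height ω :=
  csInf_le (M.finite_heights A B).bddBelow ⟨ω, h, rfl⟩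

lemma exists_height_eq_commHeight {A B : Set X} (hA : A.Nonempty) (hB : B.Nonempty) :
    ∃ ω, M.IsPath A B ω ∧ M.height ω = M.commHeight A B := by
  obtain ⟨a, ha⟩ := hA
  obtain ⟨b, hb⟩ := hB
  obtain ⟨ω, hω, -⟩ := M.exists_isPath_of_reach ha hb trivial (M.reach_true a b)
  have hne : (M.height '' {ω | M.IsPath A B ω}).Nonempty := ⟨_, ω, hω, rfl⟩
  exact hne.csInf_mem (M.finite_heights A B)

/-- Trades heights for connectivity of a strict sublevel set. The condition on `y` is stated
separately because `Reach` imposes nothing on a trivial chain. -/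
lemma commHeight_lt_iff {B : Set X} (hB : B.Nonempty) {y : X} {c : ℝ} :
    M.commHeight {y} B < c ↔ M.H y < c ∧ ∃ b ∈ B, M.Reach (fun v => M.H v < c) y b := by
  constructor
  · intro h
    obtain ⟨ω, hω, hh⟩ := M.exists_height_eq_commHeight (Set.singleton_nonempty y) hB
    obtain ⟨a, rfl, b, hb, hP, hr⟩ := hω.exists_reach (P := fun v => M.H v < c)
      fun v hv => (M.le_height hv).trans_lt (hh ▸ h)
    exact ⟨hP, b, hb, hr⟩
  · rintro ⟨hy, b, hb, hr⟩
    obtain ⟨ω, hω, hP⟩ := M.exists_isPath_of_reach (Set.mem_singleton y) hb hy hr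
    obtain ⟨v, hv, hv'⟩ := M.exists_mem_height_eq hω.ne_nil
    exact (M.commHeight_le hω).trans_lt (hv' ▸ hP v hv)

lemma isOptimalPath_of_le {x : X} {A : Set X} {ω : List X} (h : M.IsPath {x} A ω)
    (hω : ∀ v ∈ ω, M.H v ≤ M.commHeight {x} A) : M.IsOptimalPath x A ω := by
  refine ⟨h, le_antisymm ?_ (M.commHeight_le h)⟩
  obtain ⟨v, hv, hv'⟩ := M.exists_mem_height_eq h.ne_nil
  exact hv' ▸ hω v hv

/-! ### Basins and gates -/

section Gate

variable {x : X} {A : Set X}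

lemma mem_basin_iff {B : Set X} (hB : B.Nonempty) {y : X} :
    y ∈ M.basin x A B ↔ M.H y < M.commHeight {x} A ∧
      ∃ b ∈ B, M.Reach (fun v => M.H v < M.commHeight {x} A) y b :=
  M.commHeight_lt_iff hB

lemma disjoint_basin (hA : A.Nonempty) : Disjoint (M.basin x A {x}) (M.basin x A A) := by
  rw [Set.disjoint_left]
  intro y h1 h2
  rw [M.mem_basin_iff (Set.singleton_nonempty x)] at h1
  rw [M.mem_basin_iff hA] at h2
  obtain ⟨hy, b, hb, hr⟩ := h1
  rw [Set.mem_singleton_iff.1 hb] at hr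
  obtain ⟨-, a, ha, hr'⟩ := h2
  refine lt_irrefl (M.commHeight {x} A) ((M.commHeight_lt_iff hA).2 ⟨?_, a, ha,
    hr.symm.trans hr'⟩)
  rcases Relation.ReflTransGen.cases_tail hr with rfl | ⟨_, _, h⟩
  · exact hy
  · exact h.2.2

lemma mem_basin_of_allowed {B : Set X} (hB : B.Nonempty) {y z : X} (hy : y ∈ M.basin x A B)
    (hyz : M.Allowed y z) (hz : M.H z < M.commHeight {x} A) : z ∈ M.basin x A B := by
  rw [M.mem_basin_iff hB] at hy ⊢
  obtain ⟨hy, b, hb, hr⟩ := hy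
  exact ⟨hz, b, hb, Relation.ReflTransGen.head ⟨hyz.symm, hz, hy⟩ hr⟩

/-- Steps that stay below Φ never leave a basin, so a chain that escapes must step from the basin
onto `w`. -/
lemma exists_adj_basin {B : Set X} (hB : B.Nonempty) {w y z : X}
    (hw : M.H w = M.commHeight {x} A) (hy : y ∈ M.basin x A B) (hz : z ∉ M.basin x A B)
    (h : M.Reach (fun v => M.H v < M.commHeight {x} A ∨ v = w) y z) :
    ∃ u ∈ M.basin x A B, 0 < M.q w u := by
  by_contra! hcon
  refine hz ?_
  unfold Reach at h
  induction h with
  | refl => exact hy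
  | @tail b c _ hbc ih =>
    have hb : b ∈ M.basin x A B := by
      by_contra hb'
      exact hb' (ih hb')
    obtain ⟨hall, -, hc | rfl⟩ := hbc
    · exact M.mem_basin_of_allowed hB hb hall hc
    · rcases eq_or_ne b c with rfl | hne
      · exact hb
      · exact absurd ((M.allowed_iff hne.symm).1 hall.symm) (hcon b hb).not_gt

/-- If the minimal gate is unique, each of its states is the only saddle on some optimal path. -/
lemma exists_isOptimalPath_of_unique {W : Finset X}
    (hWuniq : ∀ W', M.IsMinimalGate x A W' → W' = W) {w : X} (hw : w ∈ W) :
    ∃ ω, M.IsOptimalPath x A ω ∧ ∀ v ∈ ω, M.H v < M.commHeight {x} A ∨ v = w := by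
  classical
  by_contra! hcon
  -- If every optimal path met a saddle other than `w`, these saddles would form a gate; a minimal
  -- gate inside it would omit `w` and so differ from `W`.
  let S : Finset X := Finset.univ.filter fun v => M.H v = M.commHeight {x} A ∧ v ≠ w
  have hS : M.IsGate x A S := by
    refine ⟨fun v hv => (Finset.mem_filter.1 hv).2.1, fun ω hω => ?_⟩
    obtain ⟨v, hv, h1, h2⟩ := hcon ω hω
    exact ⟨v, Finset.mem_filter.2 ⟨Finset.mem_univ _,
      le_antisymm (hω.2 ▸ M.le_height hv) h1, h2⟩, hv⟩
  obtain ⟨W', hle, hmin⟩ := exists_minimal_le_of_wellFoundedLT (M.IsGate x A) S hS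
  have hW' : M.IsMinimalGate x A W' := by
    refine ⟨hmin.prop, fun U hU => ?_⟩
    by_contra! hU'
    exact hmin.not_prop_of_lt hU ⟨fun v hv => hmin.prop.1 (hU.1 hv), fun ω hω => hU' ω hω⟩
  rw [hWuniq W' hW'] at hle
  exact (Finset.mem_filter.1 (hle hw)).2.2 rfl

end Gate

end MetropolisDynamics

/-- Splitting a symmetric double sum along a set `W` and its complement. -/
lemma half_sum_symm_eq {X : Type*} [Fintype X] [DecidableEq X] (t : X → X → ℝ)
    (ht : ∀ y z, t y z = t z y) (W : Finset X) :
    1 / 2 * ∑ y, ∑ z, t y z = ∑ z ∈ W, ∑ w ∈ Wᶜ, t z w +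
      (1 / 2 * ∑ z ∈ W, ∑ w ∈ W, t z w + 1 / 2 * ∑ z ∈ Wᶜ, ∑ w ∈ Wᶜ, t z w) := by
  have h1 : ∑ z ∈ Wᶜ, ∑ w ∈ W, t z w = ∑ z ∈ W, ∑ w ∈ Wᶜ, t z w := by
    rw [Finset.sum_comm]
    exact Finset.sum_congr rfl fun _ _ => Finset.sum_congr rfl fun _ _ => ht _ _
  simp only [← Finset.sum_add_sum_compl W, Finset.sum_add_distrib]
  rw [h1]
  ring

namespace MetropolisDynamics

variable {X : Type*} [Fintype X] [DecidableEq X] (M : MetropolisDynamics X)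

/-! ### The Dirichlet form rescaled at an energy level -/

/-- The conductances, rescaled by the factor `Z_β * exp (β Φ)`. -/
noncomputable def conductance (β Φ : ℝ) (y z : X) : ℝ :=
  M.q y z * Real.exp (-β * (max (M.H y) (M.H z) - Φ))

/-- The Dirichlet form, rescaled by the factor `Z_β * exp (β Φ)`. -/
noncomputable def energy (β Φ : ℝ) (f : X → ℝ) : ℝ :=
  1 / 2 * ∑ y, ∑ z, M.conductance β Φ y z * (f y - f z) ^ 2

lemma conductance_symm (β Φ : ℝ) (y z : X) :
    M.conductance β Φ y z = M.conductance β Φ z y := by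
  rw [conductance, conductance, M.q_symm, max_comm]

lemma energy_term_symm (β Φ : ℝ) (f : X → ℝ) (y z : X) :
    M.conductance β Φ y z * (f y - f z) ^ 2 = M.conductance β Φ z y * (f z - f y) ^ 2 := by
  rw [M.conductance_symm]; ring

lemma energy_term_nonneg (β Φ : ℝ) (f : X → ℝ) (y z : X) :
    0 ≤ M.conductance β Φ y z * (f y - f z) ^ 2 := by
  rcases eq_or_ne y z with rfl | h
  · simp
  · exact mul_nonneg (mul_nonneg (M.q_nonneg y z h) (Real.exp_pos _).le) (sq_nonneg _)

/-- The scaling is chosen so that bonds at a state of energy Φ carry exactly the jump probabilities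
out of it. -/
lemma conductance_eq_p (β : ℝ) {Φ : ℝ} {y z : X} (h : y ≠ z) (hy : M.H y = Φ) :
    M.conductance β Φ y z = M.p β y z := by
  rw [M.p_of_ne β h, conductance, hy, ← max_sub_sub_right, sub_self, max_comm]

lemma p_eq_q (β : ℝ) {y z : X} (h : M.H z < M.H y) : M.p β y z = M.q y z := by
  rw [M.p_of_ne β (by rintro rfl; exact lt_irrefl _ h), max_eq_right (by linarith)]
  simp

/-- Detailed balance: μ(y) p(y,z) depends on the energies only through max(H y, H z). The diagonal
of `p` drops out since f y - f y = 0. -/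
lemma dirichlet_eq (β Φ : ℝ) (f : X → ℝ) :
    M.dirichlet β f = Real.exp (-β * Φ) / M.Z β * M.energy β Φ f := by
  rw [dirichlet, energy, mul_left_comm]
  congr 1
  rw [Finset.mul_sum]
  refine Finset.sum_congr rfl fun y _ => ?_
  rw [Finset.mul_sum]
  refine Finset.sum_congr rfl fun z _ => ?_
  rcases eq_or_ne y z with rfl | h
  · simp
  · have : Real.exp (-β * M.H y) * Real.exp (-β * max (M.H z - M.H y) 0) =
        Real.exp (-β * Φ) * Real.exp (-β * (max (M.H y) (M.H z) - Φ)) := by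
      rw [← Real.exp_add, ← Real.exp_add]
      congr 1
      rw [← sub_self (M.H y), max_sub_sub_right, max_comm]
      ring
    rw [M.p_of_ne β h, gibbs, conductance]
    linear_combination (M.q y z * (f y - f z) ^ 2 / M.Z β) * this

lemma energy_nonneg (β Φ : ℝ) (f : X → ℝ) : 0 ≤ M.energy β Φ f :=
  mul_nonneg (by norm_num) (Finset.sum_nonneg fun _ _ => Finset.sum_nonneg fun _ _ =>
    M.energy_term_nonneg _ _ _ _ _)

lemma Z_pos [Nonempty X] (β : ℝ) : 0 < M.Z β :=
  Finset.sum_pos (fun _ _ => Real.exp_pos _) Finset.univ_nonempty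

lemma le_energy (β Φ : ℝ) (f : X → ℝ) (W : Finset X) :
    ∑ z ∈ W, ∑ w ∈ Wᶜ, M.conductance β Φ z w * (f z - f w) ^ 2 ≤ M.energy β Φ f := by
  rw [energy, half_sum_symm_eq _ (M.energy_term_symm β Φ f) W]
  have h (U V : Finset X) : 0 ≤ ∑ z ∈ U, ∑ w ∈ V, M.conductance β Φ z w * (f z - f w) ^ 2 :=
    Finset.sum_nonneg fun _ _ => Finset.sum_nonneg fun _ _ => M.energy_term_nonneg _ _ _ _ _
  linarith [h W W, h Wᶜ Wᶜ]

lemma term_le_energy (β Φ : ℝ) (f : X → ℝ) {y z : X} (h : y ≠ z) :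
    M.conductance β Φ y z * (f y - f z) ^ 2 ≤ M.energy β Φ f := by
  refine le_trans ?_ (M.le_energy β Φ f {y})
  rw [Finset.sum_singleton]
  exact Finset.single_le_sum (f := fun z => M.conductance β Φ y z * (f y - f z) ^ 2)
    (fun _ _ => M.energy_term_nonneg _ _ _ _ _) (by simpa using h.symm)

lemma tendsto_conductance_zero {Φ : ℝ} {y z : X} (h : Φ < max (M.H y) (M.H z)) :
    Tendsto (fun β => M.conductance β Φ y z) atTop (𝓝 0) := by
  have h1 : Tendsto (fun β : ℝ => -β * (max (M.H y) (M.H z) - Φ)) atTop atBot :=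
    tendsto_neg_atTop_atBot.atBot_mul_const (sub_pos.2 h)
  simpa [conductance] using (Real.tendsto_exp_atBot.comp h1).const_mul (M.q y z)

lemma tendsto_conductance_atTop {Φ : ℝ} {y z : X} (hq : 0 < M.q y z)
    (h : max (M.H y) (M.H z) < Φ) :
    Tendsto (fun β => M.conductance β Φ y z) atTop atTop := by
  have h1 : Tendsto (fun β : ℝ => -β * (max (M.H y) (M.H z) - Φ)) atTop atTop :=
    tendsto_neg_atTop_atBot.atBot_mul_const_of_neg (sub_neg.2 h)
  exact (Real.tendsto_exp_atTop.comp h1).const_mul_atTop hq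

/-- Functions of bounded rescaled energy are asymptotically constant on the components of the
sublevel set. -/
lemma eventually_abs_sub_le_of_reach {Φ K : ℝ} {y z : X} (h : M.Reach (fun v => M.H v < Φ) y z) :
    ∀ ε > 0, ∀ᶠ β in atTop, ∀ f : X → ℝ, M.energy β Φ f ≤ K → |f y - f z| ≤ ε := by
  unfold Reach at h
  induction h with
  | refl => exact fun ε hε => Eventually.of_forall fun β f _ => by simpa using hε.le
  | @tail b c _ hbc ih =>
    intro ε hε
    rcases eq_or_ne b c with rfl | hne
    · exact ih ε hε
    -- Beyond this threshold a jump of `f` larger than ε/2 across the bond would alone cost more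
    -- than K; |K| + 1 is positive whatever the sign of K.
    have hlim := M.tendsto_conductance_atTop ((M.allowed_iff hne).1 hbc.1) (max_lt hbc.2.1 hbc.2.2)
    filter_upwards [ih (ε / 2) (half_pos hε),
      hlim.eventually_ge_atTop ((|K| + 1) / (ε / 2) ^ 2)] with β h1 h2 f hf
    have h3 : |f b - f c| ≤ ε / 2 := by
      by_contra! hcon
      have h4 : (ε / 2) ^ 2 < (f b - f c) ^ 2 := by
        rw [← sq_abs (f b - f c)]
        exact pow_lt_pow_left₀ hcon (half_pos hε).le two_ne_zero
      have h5 := M.term_le_energy β Φ f hne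
      rw [div_le_iff₀ (by positivity)] at h2
      have h6 : 0 < M.conductance β Φ b c := by
        by_contra! h
        nlinarith [abs_nonneg K, sq_nonneg (ε / 2)]
      nlinarith [le_abs_self K]
    calc |f y - f c| ≤ |f y - f b| + |f b - f c| := abs_sub_le _ _ _
      _ ≤ ε / 2 + ε / 2 := add_le_add (h1 f hf) h3
      _ = ε := add_halves ε

/-! ### Rates out of the gate -/

-- Downhill jumps have no exponential factor; this is why `k` does not depend on β.
open Classical in
lemma pInto_eq_sum_q {β : ℝ} {z : X} {B : Set X} (h : ∀ w ∈ B, M.H w < M.H z) :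
    M.pInto β z B = ∑ w ∈ Finset.univ.filter (fun w => w ∈ B), M.q z w :=
  Finset.sum_congr rfl fun w hw => M.p_eq_q β (h w (Finset.mem_filter.1 hw).2)

lemma pInto_nonneg {β : ℝ} {z : X} {B : Set X} (h : ∀ w ∈ B, M.H w < M.H z) :
    0 ≤ M.pInto β z B := by
  classical
  rw [M.pInto_eq_sum_q h]
  exact Finset.sum_nonneg fun w hw => M.q_nonneg z w fun e =>
    lt_irrefl _ (e ▸ h w (Finset.mem_filter.1 hw).2)

lemma pInto_pos {β : ℝ} {z : X} {B : Set X} (h : ∀ w ∈ B, M.H w < M.H z) {u : X} (hu : u ∈ B)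
    (hq : 0 < M.q z u) : 0 < M.pInto β z B := by
  classical
  rw [M.pInto_eq_sum_q h]
  exact Finset.sum_pos' (fun w hw => M.q_nonneg z w fun e =>
    lt_irrefl _ (e ▸ h w (Finset.mem_filter.1 hw).2)) ⟨u, by simpa using hu, hq⟩

/-- Complete the square in `s`; the minimizer is a / (a + b). -/
lemma mul_div_add_le {a b s : ℝ} (ha : 0 ≤ a) (hb : 0 ≤ b) :
    a * b / (a + b) ≤ a * (s - 1) ^ 2 + b * s ^ 2 := by
  rcases (add_nonneg ha hb).eq_or_lt with h | h
  · rw [← h, div_zero]; positivity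
  · rw [div_le_iff₀ h]
    nlinarith [sq_nonneg ((a + b) * s - a)]

lemma mul_div_add_eq {a b : ℝ} (h : a + b ≠ 0) :
    a * (a / (a + b) - 1) ^ 2 + b * (a / (a + b)) ^ 2 = a * b / (a + b) := by
  field_simp
  ring

/-! ### Energy bounds across a set of states at level Φ -/

section Gate

variable {Φ : ℝ} {W : Finset X} {Q Q' : Set X}

/-- Lower bound for the rescaled energy of a function that is almost `1` on `Q` and almost `0`
on `Q'`. -/
lemma sum_sub_le_energy (hW : ∀ z ∈ W, M.H z = Φ) (hQ : ∀ w ∈ Q, M.H w < Φ)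
    (hQ' : ∀ w ∈ Q', M.H w < Φ) (hdisj : Disjoint Q Q') {β η : ℝ} {f : X → ℝ}
    (hf : ∀ y, f y ∈ Set.Icc (0 : ℝ) 1) (h1 : ∀ y ∈ Q, |f y - 1| ≤ η) (h0 : ∀ y ∈ Q', |f y| ≤ η) :
    ∑ z ∈ W, M.pInto β z Q * M.pInto β z Q' / (M.pInto β z Q + M.pInto β z Q') -
      2 * η * ∑ z ∈ W, (M.pInto β z Q + M.pInto β z Q') ≤ M.energy β Φ f := by
  classical
  refine le_trans ?_ (M.le_energy β Φ f W)
  rw [Finset.mul_sum, ← Finset.sum_sub_distrib]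
  refine Finset.sum_le_sum fun z hz => ?_
  have hzQ : ∀ w ∈ Q, M.H w < M.H z := fun w hw => hW z hz ▸ hQ w hw
  have hzQ' : ∀ w ∈ Q', M.H w < M.H z := fun w hw => hW z hz ▸ hQ' w hw
  have key (B : Set X) (hB : ∀ w ∈ B, M.H w < M.H z) (s : ℝ) (hs : s ∈ Set.Icc (0 : ℝ) 1)
      (hsB : ∀ w ∈ B, |f w - s| ≤ η) :
      M.pInto β z B * (f z - s) ^ 2 - 2 * η * M.pInto β z B ≤
        ∑ w ∈ Finset.univ.filter (fun w => w ∈ B), M.conductance β Φ z w * (f z - f w) ^ 2 := by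
    rw [pInto, Finset.mul_sum, Finset.sum_mul, ← Finset.sum_sub_distrib]
    refine Finset.sum_le_sum fun w hw => ?_
    have hwB := (Finset.mem_filter.1 hw).2
    have hne : z ≠ w := by rintro rfl; exact lt_irrefl _ (hB _ hwB)
    have hp : 0 ≤ M.p β z w := by rw [M.p_eq_q β (hB w hwB)]; exact M.q_nonneg z w hne
    rw [M.conductance_eq_p β hne (hW z hz)]
    -- The difference of the squares is (f w - s)(2 f z - s - f w), whose second factor is at most 2
    -- in modulus because all values lie in [0, 1].
    have h2 : (f z - s) ^ 2 - 2 * η ≤ (f z - f w) ^ 2 := by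
      have h3 := abs_le.1 (hsB w hwB)
      have h4 : |(f w - s) * (2 * f z - s - f w)| ≤ η * 2 := by
        rw [abs_mul]
        refine mul_le_mul (hsB w hwB) ?_ (abs_nonneg _) ((abs_nonneg _).trans (hsB w hwB))
        rw [abs_le]
        constructor <;> linarith [(hf z).1, (hf z).2, (hf w).1, (hf w).2, hs.1, hs.2]
      nlinarith [(abs_le.1 h4).2]
    nlinarith [mul_le_mul_of_nonneg_left h2 hp]
  have hsub : Finset.univ.filter (fun w => w ∈ Q) ∪ Finset.univ.filter (fun w => w ∈ Q') ⊆ Wᶜ := by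
    intro w hw
    rw [Finset.mem_compl]
    intro hwW
    rcases Finset.mem_union.1 hw with hw | hw
    · exact (hQ w (Finset.mem_filter.1 hw).2).ne (hW w hwW)
    · exact (hQ' w (Finset.mem_filter.1 hw).2).ne (hW w hwW)
  have hd : Disjoint (Finset.univ.filter (fun w => w ∈ Q))
      (Finset.univ.filter (fun w => w ∈ Q')) := by
    rw [Finset.disjoint_left]
    intro w hw hw'
    exact Set.disjoint_left.1 hdisj (Finset.mem_filter.1 hw).2 (Finset.mem_filter.1 hw').2
  have h3 := Finset.sum_le_sum_of_subset_of_nonneg hsub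
    (f := fun w => M.conductance β Φ z w * (f z - f w) ^ 2)
    (fun _ _ _ => M.energy_term_nonneg _ _ _ _ _)
  rw [Finset.sum_union hd] at h3
  have k1 := key Q hzQ 1 ⟨zero_le_one, le_rfl⟩ h1
  have k0 := key Q' hzQ' 0 ⟨le_rfl, zero_le_one⟩ (by simpa using h0)
  rw [sub_zero] at k0
  have := mul_div_add_le (s := f z) (M.pInto_nonneg (β := β) hzQ) (M.pInto_nonneg (β := β) hzQ')
  linarith

open Classical in
/-- The test function for the upper bound: `1` on `C`, `0` outside `C ∪ W`, and the equilibrium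
value on `W`. -/
noncomputable def gateFunction (W : Finset X) (Q Q' C : Set X) (z : X) : ℝ :=
  if z ∈ W then M.pInto 1 z Q / (M.pInto 1 z Q + M.pInto 1 z Q') else if z ∈ C then 1 else 0

lemma gateFunction_mem_Icc (hW : ∀ z ∈ W, M.H z = Φ) (hQ : ∀ w ∈ Q, M.H w < Φ)
    (hQ' : ∀ w ∈ Q', M.H w < Φ) (C : Set X) (z : X) :
    M.gateFunction W Q Q' C z ∈ Set.Icc (0 : ℝ) 1 := by
  classical
  unfold gateFunction
  split_ifs with h h'
  · have h1 := M.pInto_nonneg (β := 1) (z := z) (B := Q) fun w hw => hW z h ▸ hQ w hw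
    have h2 := M.pInto_nonneg (β := 1) (z := z) (B := Q') fun w hw => hW z h ▸ hQ' w hw
    exact ⟨by positivity, div_le_one_of_le₀ (by linarith) (by positivity)⟩
  · simp
  · simp

lemma pInto_eq_pInto {β β' : ℝ} {z : X} {B : Set X} (h : ∀ w ∈ B, M.H w < M.H z) :
    M.pInto β z B = M.pInto β' z B := by
  classical
  rw [M.pInto_eq_sum_q h, M.pInto_eq_sum_q h]

/-- Only bonds from `W` to `Q ∪ Q'` survive: `hout` removes all others at `W`, those inside `W`
included, and `hC` those across the boundary of `C` away from `W`. -/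
lemma tendsto_energy_gateFunction {C : Set X} (hW : ∀ z ∈ W, M.H z = Φ)
    (hQ : ∀ w ∈ Q, M.H w < Φ) (hQ' : ∀ w ∈ Q', M.H w < Φ)
    (hpos : ∀ z ∈ W, 0 < M.pInto 1 z Q + M.pInto 1 z Q')
    (hout : ∀ y ∈ W, ∀ w, w ∉ Q ∪ Q' → w ≠ y → Tendsto (fun β => M.p β y w) atTop (𝓝 0))
    (hQC : Q ⊆ C) (hQ'C : Disjoint C Q')
    (hC : ∀ y ∈ C, ∀ z ∉ C, z ∉ W → 0 < M.q y z → Φ < max (M.H y) (M.H z)) :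
    Tendsto (fun β => M.energy β Φ (M.gateFunction W Q Q' C)) atTop
      (𝓝 (∑ z ∈ W, M.pInto 1 z Q * M.pInto 1 z Q' / (M.pInto 1 z Q + M.pInto 1 z Q'))) := by
  classical
  set f := M.gateFunction W Q Q' C with hf
  have hWQ : ∀ w ∈ W, w ∉ Q ∪ Q' := by
    rintro w hw (h | h)
    · exact (hQ w h).ne (hW w hw)
    · exact (hQ' w h).ne (hW w hw)
  have hCC : ∀ y ∈ C, ∀ z ∉ C, y ∉ W → z ∉ W →
      Tendsto (fun β => M.conductance β Φ y z) atTop (𝓝 0) := by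
    intro y hy z hz hyW hzW
    have hne : y ≠ z := by rintro rfl; exact hz hy
    rcases (M.q_nonneg y z hne).eq_or_lt with h | h
    · simp [conductance, ← h]
    · exact M.tendsto_conductance_zero (hC y hy z hz hzW h)
  simp only [energy, half_sum_symm_eq _ (M.energy_term_symm _ Φ f) W]
  rw [show (∑ z ∈ W, M.pInto 1 z Q * M.pInto 1 z Q' / (M.pInto 1 z Q + M.pInto 1 z Q')) =
    (∑ z ∈ W, M.pInto 1 z Q * M.pInto 1 z Q' / (M.pInto 1 z Q + M.pInto 1 z Q')) +
      (1 / 2 * ∑ z ∈ W, ∑ w ∈ W, (0 : ℝ) + 1 / 2 * ∑ z ∈ Wᶜ, ∑ w ∈ Wᶜ, (0 : ℝ)) by simp]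
  refine Tendsto.add (tendsto_finsetSum _ fun z hz => ?_) (Tendsto.add
    ((tendsto_finsetSum _ fun z hz => tendsto_finsetSum _ fun w hw => ?_).const_mul _)
    ((tendsto_finsetSum _ fun z hz => tendsto_finsetSum _ fun w hw => ?_).const_mul _))
  · have hzQ : ∀ w ∈ Q, M.H w < M.H z := fun w hw => hW z hz ▸ hQ w hw
    have hzQ' : ∀ w ∈ Q', M.H w < M.H z := fun w hw => hW z hz ▸ hQ' w hw
    have hfz : f z = M.pInto 1 z Q / (M.pInto 1 z Q + M.pInto 1 z Q') := by
      simp [hf, gateFunction, hz]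
    rw [← mul_div_add_eq (hpos z hz).ne', ← hfz]
    have hsum : M.pInto 1 z Q * (f z - 1) ^ 2 + M.pInto 1 z Q' * f z ^ 2 =
        ∑ w ∈ Wᶜ, if w ∈ Q then M.q z w * (f z - 1) ^ 2 else
          if w ∈ Q' then M.q z w * f z ^ 2 else 0 := by
      rw [M.pInto_eq_sum_q hzQ, M.pInto_eq_sum_q hzQ', Finset.sum_mul, Finset.sum_mul,
        Finset.sum_filter, Finset.sum_filter, ← Finset.sum_add_distrib]
      rw [← Finset.sum_add_sum_compl W]
      rw [Finset.sum_eq_zero (s := W), zero_add]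
      · refine Finset.sum_congr rfl fun w _ => ?_
        by_cases h : w ∈ Q
        · have h' : w ∉ Q' := fun h' => Set.disjoint_left.1 hQ'C (hQC h) h'
          simp [h, h']
        · simp [h]
      · intro w hw
        have := hWQ w hw
        rw [Set.mem_union, not_or] at this
        simp [this.1, this.2]
    rw [hsum]
    refine tendsto_finsetSum _ fun w hw => ?_
    have hwW := Finset.mem_compl.1 hw
    have hne : z ≠ w := by rintro rfl; exact hwW hz
    simp only [M.conductance_eq_p _ hne (hW z hz)]
    split_ifs with h h'
    · have : f w = 1 := by simp [hf, gateFunction, hwW, hQC h]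
      simp [M.p_eq_q _ (hzQ w h), this]
    · have hwC : w ∉ C := fun h => Set.disjoint_left.1 hQ'C h h'
      have : f w = 0 := by simp [hf, gateFunction, hwW, hwC]
      simp [M.p_eq_q _ (hzQ' w h'), this]
    · simpa using (hout z hz w (by simp [h, h']) hne.symm).mul_const ((f z - f w) ^ 2)
  · rcases eq_or_ne z w with rfl | hne
    · simp
    · simp only [M.conductance_eq_p _ hne (hW z hz)]
      simpa using (hout z hz w (hWQ w hw) hne.symm).mul_const ((f z - f w) ^ 2)
  · have hz := Finset.mem_compl.1 hz
    have hw := Finset.mem_compl.1 hw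
    by_cases hzC : z ∈ C <;> by_cases hwC : w ∈ C
    · simp [hf, gateFunction, hz, hw, hzC, hwC]
    · simpa using (hCC z hzC w hwC hz hw).mul_const ((f z - f w) ^ 2)
    · simp only [M.energy_term_symm _ Φ f z w]
      simpa using (hCC w hwC z hzC hw hz).mul_const ((f w - f z) ^ 2)
    · simp [hf, gateFunction, hz, hw, hzC, hwC]

end Gate

end MetropolisDynamics

namespace MetropolisDynamics

variable {X : Type*} [Fintype X] [DecidableEq X] (M : MetropolisDynamics X)

/-! ### Asymptotics of the capacity -/

section Capacity

variable {x : X} {A : Set X} {W : Finset X}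

/-- The sum of the gate conductances is asymptotically a lower bound for the rescaled energy. -/
lemma eventually_le_energy {k ε : ℝ} (hA : A.Nonempty) (hW : ∀ z ∈ W, M.H z = M.commHeight {x} A)
    (hk : k = ∑ z ∈ W, M.pInto 1 z (M.basin x A {x}) * M.pInto 1 z (M.basin x A A) /
      (M.pInto 1 z (M.basin x A {x}) + M.pInto 1 z (M.basin x A A)))
    (hε : 0 < ε) :
    ∀ᶠ β in atTop, ∀ f : X → ℝ, (∀ y, f y ∈ Set.Icc (0 : ℝ) 1) → f x = 1 →
      (∀ y ∈ A, f y = 0) → k - ε ≤ M.energy β (M.commHeight {x} A) f := by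
  set Φ := M.commHeight {x} A
  set Q := M.basin x A {x}
  set Q' := M.basin x A A
  have hQ : ∀ w ∈ Q, M.H w < Φ := fun w hw =>
    ((M.mem_basin_iff (Set.singleton_nonempty x)).1 hw).1
  have hQ' : ∀ w ∈ Q', M.H w < Φ := fun w hw => ((M.mem_basin_iff hA).1 hw).1
  set S := ∑ z ∈ W, (M.pInto 1 z Q + M.pInto 1 z Q')
  have hS : 0 ≤ S := Finset.sum_nonneg fun z hz => add_nonneg
    (M.pInto_nonneg fun w hw => hW z hz ▸ hQ w hw)
    (M.pInto_nonneg fun w hw => hW z hz ▸ hQ' w hw)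
  set η := ε / (2 * (S + 1))
  have hη : 0 < η := by positivity
  have hηS : 2 * η * S ≤ ε := by
    have : 2 * η * (S + 1) = ε := by simp only [η]; field_simp
    nlinarith
  have e1 : ∀ᶠ β in atTop, ∀ y, y ∈ Q → ∀ f : X → ℝ, M.energy β Φ f ≤ k →
      |f y - f x| ≤ η := by
    refine eventually_all.2 fun y => ?_
    by_cases hy : y ∈ Q
    · obtain ⟨-, b, hb, hr⟩ := (M.mem_basin_iff (Set.singleton_nonempty x)).1 hy
      rw [Set.mem_singleton_iff.1 hb] at hr
      filter_upwards [M.eventually_abs_sub_le_of_reach (K := k) hr η hη] with β h _ using h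
    · exact Eventually.of_forall fun _ h => absurd h hy
  have e2 : ∀ᶠ β in atTop, ∀ y, y ∈ Q' → ∀ f : X → ℝ, M.energy β Φ f ≤ k →
      ∃ a ∈ A, |f y - f a| ≤ η := by
    refine eventually_all.2 fun y => ?_
    by_cases hy : y ∈ Q'
    · obtain ⟨-, a, ha, hr⟩ := (M.mem_basin_iff hA).1 hy
      filter_upwards [M.eventually_abs_sub_le_of_reach (K := k) hr η hη] with β h _ f hf
        using ⟨a, ha, h f hf⟩
    · exact Eventually.of_forall fun _ h => absurd h hy
  filter_upwards [e1, e2] with β h1 h2 f hf hfx hfA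
  -- Near-constancy on the basins is needed only for energy at most `k`; otherwise the bound is
  -- trivial.
  rcases le_total (M.energy β Φ f) k with hle | hle
  · have := M.sum_sub_le_energy hW hQ hQ' (M.disjoint_basin hA) (β := β) hf
      (fun y hy => hfx ▸ h1 y hy f hle) fun y hy => by
        obtain ⟨a, ha, h⟩ := h2 y hy f hle
        rwa [hfA a ha, sub_zero] at h
    have c1 : ∀ z ∈ W, M.pInto β z Q = M.pInto 1 z Q := fun z hz =>
      M.pInto_eq_pInto fun w hw => hW z hz ▸ hQ w hw
    have c2 : ∀ z ∈ W, M.pInto β z Q' = M.pInto 1 z Q' := fun z hz =>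
      M.pInto_eq_pInto fun w hw => hW z hz ▸ hQ' w hw
    have c3 : ∑ z ∈ W, (M.pInto β z Q + M.pInto β z Q') = S :=
      Finset.sum_congr rfl fun z hz => by rw [c1 z hz, c2 z hz]
    rw [Finset.sum_congr rfl fun z hz => by rw [c1 z hz, c2 z hz], c3, ← hk] at this
    linarith
  · linarith

/-- A unique minimal gate communicates with the basin of `x` and with that of `A`. -/
lemma pInto_basin_pos (hA : A.Nonempty) (hx : M.H x < M.commHeight {x} A)
    (hHA : ∀ a ∈ A, M.H a < M.commHeight {x} A) (hW : M.IsMinimalGate x A W)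
    (hWuniq : ∀ W', M.IsMinimalGate x A W' → W' = W) {z : X} (hz : z ∈ W) :
    0 < M.pInto 1 z (M.basin x A {x}) ∧ 0 < M.pInto 1 z (M.basin x A A) := by
  obtain ⟨ω, hω, hωz⟩ := M.exists_isOptimalPath_of_unique hWuniq hz
  obtain ⟨b, hb, a, ha, -, hr⟩ := hω.1.exists_reach hωz
  rw [Set.mem_singleton_iff.1 hb] at hr
  have hxQ : x ∈ M.basin x A {x} := (M.mem_basin_iff (Set.singleton_nonempty x)).2
    ⟨hx, x, rfl, Relation.ReflTransGen.refl⟩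
  have haQ : a ∈ M.basin x A A := (M.mem_basin_iff hA).2
    ⟨hHA a ha, a, ha, Relation.ReflTransGen.refl⟩
  have hd := Set.disjoint_left.1 (M.disjoint_basin (x := x) hA)
  have hHz : M.H z = M.commHeight {x} A := hW.1.1 hz
  obtain ⟨u, hu, hqu⟩ := M.exists_adj_basin (Set.singleton_nonempty x) hHz hxQ
    (fun h => hd h haQ) hr
  obtain ⟨v, hv, hqv⟩ := M.exists_adj_basin hA hHz haQ (hd hxQ) hr.symm
  exact ⟨M.pInto_pos (fun w hw => hHz ▸
      ((M.mem_basin_iff (Set.singleton_nonempty x)).1 hw).1) hu hqu,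
    M.pInto_pos (fun w hw => hHz ▸ ((M.mem_basin_iff hA).1 hw).1) hv hqv⟩

/-- Some fixed admissible function has a rescaled energy tending to the sum of the gate
conductances. -/
lemma exists_tendsto_energy (hA : A.Nonempty) (hx : M.H x < M.commHeight {x} A)
    (hHA : ∀ a ∈ A, M.H a < M.commHeight {x} A) (hW : M.IsMinimalGate x A W)
    (hWuniq : ∀ W', M.IsMinimalGate x A W' → W' = W)
    (hout : ∀ y ∈ W, ∀ w, w ∉ M.basin x A {x} ∪ M.basin x A A → w ≠ y →
      Tendsto (fun β => M.p β y w) atTop (𝓝 0)) :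
    ∃ f : X → ℝ, (∀ y, f y ∈ Set.Icc (0 : ℝ) 1) ∧ f x = 1 ∧ (∀ y ∈ A, f y = 0) ∧
      Tendsto (fun β => M.energy β (M.commHeight {x} A) f) atTop
        (𝓝 (∑ z ∈ W, M.pInto 1 z (M.basin x A {x}) * M.pInto 1 z (M.basin x A A) /
          (M.pInto 1 z (M.basin x A {x}) + M.pInto 1 z (M.basin x A A)))) := by
  set Φ := M.commHeight {x} A
  have hHW : ∀ z ∈ W, M.H z = Φ := fun z hz => hW.1.1 hz
  have hQ : ∀ w ∈ M.basin x A {x}, M.H w < Φ := fun w hw =>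
    ((M.mem_basin_iff (Set.singleton_nonempty x)).1 hw).1
  have hQ' : ∀ w ∈ M.basin x A A, M.H w < Φ := fun w hw => ((M.mem_basin_iff hA).1 hw).1
  let P : X → Prop := fun v => M.H v ≤ Φ ∧ v ∉ W
  have hP : ∀ v, M.H v < Φ → P v := fun v hv => ⟨hv.le, fun h => hv.ne (hHW v h)⟩
  let C : Set X := {z | P z ∧ M.Reach P x z}
  have hQC : M.basin x A {x} ⊆ C := by
    intro y hy
    obtain ⟨hy, b, hb, hr⟩ := (M.mem_basin_iff (Set.singleton_nonempty x)).1 hy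
    rw [Set.mem_singleton_iff.1 hb] at hr
    exact ⟨hP y hy, (hr.mono hP).symm⟩
  -- A common state would give a path from `x` to `A` of height at most Φ, hence optimal, that
  -- avoids the gate.
  have hQ'C : Disjoint C (M.basin x A A) := by
    rw [Set.disjoint_left]
    intro y hy hy'
    obtain ⟨-, a, ha, hr⟩ := (M.mem_basin_iff hA).1 hy'
    obtain ⟨ω, hω, hωP⟩ := M.exists_isPath_of_reach (Set.mem_singleton x) ha (hP x hx)
      (hy.2.trans (hr.mono hP))
    obtain ⟨z, hz, hzω⟩ := hW.1.2 ω (M.isOptimalPath_of_le hω fun v hv => (hωP v hv).1)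
    exact (hωP z hzω).2 hz
  have hAC : ∀ a ∈ A, a ∉ C := fun a ha h => Set.disjoint_left.1 hQ'C h
    ((M.mem_basin_iff hA).2 ⟨hHA a ha, a, ha, Relation.ReflTransGen.refl⟩)
  have hxC : x ∈ C := ⟨hP x hx, Relation.ReflTransGen.refl⟩
  have hC : ∀ y ∈ C, ∀ z ∉ C, z ∉ W → 0 < M.q y z → Φ < max (M.H y) (M.H z) := by
    intro y hy z hz hzW hq
    by_contra! hle
    have hne : y ≠ z := by rintro rfl; exact hz hy
    have hPz : P z := ⟨(le_max_right _ _).trans hle, hzW⟩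
    exact hz ⟨hPz, Relation.ReflTransGen.tail hy.2 ⟨(M.allowed_iff hne).2 hq, hy.1, hPz⟩⟩
  refine ⟨M.gateFunction W (M.basin x A {x}) (M.basin x A A) C,
    M.gateFunction_mem_Icc hHW hQ hQ' C, ?_, ?_, ?_⟩
  · simp [gateFunction, hxC.1.2, hxC]
  · intro a ha
    simp [gateFunction, (hP a (hHA a ha)).2, hAC a ha]
  · refine M.tendsto_energy_gateFunction hHW hQ hQ' (fun z hz => ?_) hout hQC hQ'C hC
    have := M.pInto_basin_pos hA hx hHA hW hWuniq hz
    exact add_pos this.1 this.2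

/-- Sharp asymptotics of the capacity when the minimal gate is unique. -/
lemma exists_cap_asymptotics (hA : A.Nonempty) (hx : M.H x < M.commHeight {x} A)
    (hHA : ∀ a ∈ A, M.H a < M.commHeight {x} A) (hW : M.IsMinimalGate x A W)
    (hWuniq : ∀ W', M.IsMinimalGate x A W' → W' = W)
    (hout : ∀ y ∈ W, ∀ w, w ∉ M.basin x A {x} ∪ M.basin x A A → w ≠ y →
      Tendsto (fun β => M.p β y w) atTop (𝓝 0)) :
    ∃ k : ℝ,
      (∀ β : ℝ, 0 < β →
        k = ∑ z ∈ W, M.pInto β z (M.basin x A {x}) * M.pInto β z (M.basin x A A) /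
          (M.pInto β z (M.basin x A {x}) + M.pInto β z (M.basin x A A))) ∧
      ∃ ε : ℝ → ℝ, Tendsto ε atTop (𝓝 0) ∧ ∀ β : ℝ, 0 < β →
        M.cap β {x} A =
          k / M.Z β * Real.exp (-β * M.commHeight {x} A) * (1 + ε β) := by
  have : Nonempty X := ⟨x⟩
  set Φ := M.commHeight {x} A
  have hHW : ∀ z ∈ W, M.H z = Φ := fun z hz => hW.1.1 hz
  obtain ⟨f, hf, hfx, hfA, hlim⟩ := M.exists_tendsto_energy hA hx hHA hW hWuniq hout
  set k := ∑ z ∈ W, M.pInto 1 z (M.basin x A {x}) * M.pInto 1 z (M.basin x A A) /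
    (M.pInto 1 z (M.basin x A {x}) + M.pInto 1 z (M.basin x A A)) with hk
  -- An optimal path exists and meets `W`, so the sum is nonempty.
  have hkpos : 0 < k := by
    obtain ⟨ω, hω⟩ := M.exists_height_eq_commHeight (Set.singleton_nonempty x) hA
    obtain ⟨z, hz, -⟩ := hW.1.2 ω hω
    refine Finset.sum_pos (fun z hz => ?_) ⟨z, hz⟩
    have := M.pInto_basin_pos hA hx hHA hW hWuniq hz
    exact div_pos (mul_pos this.1 this.2) (add_pos this.1 this.2)
  have hscale (β : ℝ) : 0 < Real.exp (-β * Φ) / M.Z β := div_pos (Real.exp_pos _) (M.Z_pos β)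
  have hmem (β : ℝ) : M.dirichlet β f ∈ M.dirichlet β '' {f | (∀ y, f y ∈ Set.Icc (0 : ℝ) 1) ∧
      (∀ y ∈ ({x} : Set X), f y = 1) ∧ ∀ y ∈ A, f y = 0} :=
    ⟨f, ⟨hf, by simpa using hfx, hfA⟩, rfl⟩
  have hupper (β : ℝ) : M.cap β {x} A / (Real.exp (-β * Φ) / M.Z β) ≤ M.energy β Φ f := by
    rw [div_le_iff₀' (hscale β), ← M.dirichlet_eq]
    refine csInf_le ⟨0, ?_⟩ (hmem β)
    rintro _ ⟨g, -, rfl⟩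
    rw [M.dirichlet_eq β Φ]
    exact mul_nonneg (hscale β).le (M.energy_nonneg _ _ _)
  have hlower (ε : ℝ) (hε : 0 < ε) :
      ∀ᶠ β in atTop, k - ε ≤ M.cap β {x} A / (Real.exp (-β * Φ) / M.Z β) := by
    filter_upwards [M.eventually_le_energy hA hHW hk hε] with β h
    rw [le_div_iff₀' (hscale β)]
    refine le_csInf ⟨_, hmem β⟩ ?_
    rintro _ ⟨g, ⟨hg, hgx, hgA⟩, rfl⟩
    rw [M.dirichlet_eq β Φ]
    exact mul_le_mul_of_nonneg_left (h g hg (hgx x rfl) hgA) (hscale β).le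
  have htend : Tendsto (fun β => M.cap β {x} A / (Real.exp (-β * Φ) / M.Z β)) atTop (𝓝 k) := by
    refine tendsto_order.2 ⟨fun a ha => ?_, fun a ha => ?_⟩
    · filter_upwards [hlower ((k - a) / 2) (by linarith)] with β h
      linarith
    · filter_upwards [hlim.eventually_lt_const ha] with β h using (hupper β).trans_lt h
  refine ⟨k, fun β _ => ?_, fun β => M.cap β {x} A / (Real.exp (-β * Φ) / M.Z β) / k - 1,
    ?_, fun β _ => ?_⟩
  · refine Finset.sum_congr rfl fun z hz => ?_
    rw [M.pInto_eq_pInto (β := 1) (β' := β) (B := M.basin x A {x}) fun w hw => hHW z hz ▸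
        ((M.mem_basin_iff (Set.singleton_nonempty x)).1 hw).1,
      M.pInto_eq_pInto (β := 1) (β' := β) (B := M.basin x A A) fun w hw => hHW z hz ▸
        ((M.mem_basin_iff hA).1 hw).1]
  · simpa [hkpos.ne'] using (htend.div_const k).sub_const 1
  · have hZ := (M.Z_pos β).ne'
    have hexp := (Real.exp_pos (-β * Φ)).ne'
    have hk0 := hkpos.ne'
    field_simp
    ring

end Capacity

/-- The communication height from a state with positive stability level to states of lower
energy exceeds the energy of that state. -/
lemma lt_commHeight {x : X} {A : Set X} (hV : 0 < M.stabilityLevel x) (hA : A.Nonempty)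
    (hAx : ∀ a ∈ A, M.H a < M.H x) : M.H x < M.commHeight {x} A := by
  obtain ⟨ω, ⟨h1, h2, b, hb, h3⟩, hω⟩ :=
    M.exists_height_eq_commHeight (Set.singleton_nonempty x) hA
  have h4 : M.IsPath {x} {y | M.H y < M.H x} ω := ⟨h1, h2, b, hAx b hb, h3⟩
  have := M.commHeight_le h4
  rw [stabilityLevel] at hV
  linarith

end MetropolisDynamics

theorem theoremt {X : Type*} [Fintype X] [DecidableEq X] (M : MetropolisDynamics X)
    (x₀ x₁ x₂ : X)
    (hs : M.groundStates = {x₀})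
    (hm : M.metastableStates = {x₁, x₂})
    (hH : M.H x₁ < M.H x₂)
    (hΓ : 0 < M.maxStabilityLevel)
    (x : X) (hx : x ∈ ({x₂, x₁} : Set X))
    (A : Set X) (hA : A = {x₀, x₁} \ {x})
    (W : Finset X) (hW : M.IsMinimalGate x A W)
    (hWuniq : ∀ W', M.IsMinimalGate x A W' → W' = W)
    (hout : ∀ y ∈ W, ∀ w, w ∉ M.basin x A {x} ∪ M.basin x A A → w ≠ y →
      Tendsto (fun β => M.p β y w) atTop (𝓝 0)) :
    ∃ k : ℝ,
      (∀ β : ℝ, 0 < β →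
        k = ∑ z ∈ W, M.pInto β z (M.basin x A {x}) * M.pInto β z (M.basin x A A) /
          (M.pInto β z (M.basin x A {x}) + M.pInto β z (M.basin x A A))) ∧
      ∃ ε : ℝ → ℝ, Tendsto ε atTop (𝓝 0) ∧ ∀ β : ℝ, 0 < β →
        M.cap β {x} A =
          k / M.Z β * Real.exp (-β * M.commHeight {x} A) * (1 + ε β) := by
  have hxm : x ∈ M.metastableStates := by
    rw [hm]
    exact hx.symm
  have hground : ∀ y ∈ M.metastableStates, M.H x₀ < M.H y := by
    intro y hy
    have h0 : x₀ ∈ M.groundStates := by simp [hs]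
    refine (h0 y).lt_of_ne fun h => hy.1 fun z => ?_
    rw [← h]
    exact h0 z
  -- Hence every path to `A` reaches lower energy, and Φ(x, A) - H x ≥ V_x = Γ_m > 0.
  have hAx : ∀ a ∈ A, M.H a < M.H x := by
    subst hA
    rintro a ⟨rfl | ha, hne⟩
    · exact hground x hxm
    · obtain rfl : a = x₁ := ha
      rcases hx with rfl | hx
      · exact hH
      · exact absurd hx.symm hne
  have hA' : A.Nonempty := by
    refine ⟨x₀, hA ▸ ⟨Or.inl rfl, ?_⟩⟩
    rintro rfl
    exact lt_irrefl _ (hground _ hxm)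
  have hlt := M.lt_commHeight (hxm.2 ▸ hΓ) hA' hAx
  exact M.exists_cap_asymptotics hA' hlt (fun a ha => (hAx a ha).trans hlt) hW hWuniq hout
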